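/- Let $n,m\ge 1$, let $D_X\in\mathbb{R}^{n\times n}$ and $D_Y\in\mathbb{R}^{m\times m}$ be symmetric matrices, and let $\mu\in\mathbb{R}^n$ and $\nu\in\mathbb{R}^m$ be probability vectors (nonnegative entries summing to $1$). Equip $\mathbb{R}^{n\times m}$ with the Frobenius inner product and norm $\|\cdot\|$, and put $$C_1=\{\pi\in\mathbb{R}^{n\times m}:\pi\ge 0,\ \pi\mathbf 1_m=\mu\},\qquad C_2=\{\pi\in\mathbb{R}^{n\times m}:\pi\ge 0,\ \pi^T\mathbf 1_n=\nu\},\qquad f(\pi)=-\operatorname{Tr}(D_X\pi D_Y\pi^T).$$ Let $$\mathcal X=\{\pi\in C_1\cap C_2:\ 0\in\nabla f(\pi)+\mathcal N_{C_1}(\pi)+\mathcal N_{C_2}(\pi)\}$$ be the set of critical points of the discrete Gromov--Wasserstein problem $\min_{\pi\in C_1\cap C_2}f(\pi)$, where $\mathcal N_C(\pi)=\{g:\langle g,y-\pi\rangle\le 0\ \text{for all } y\in C\}$ is the normal cone to $C$ at $\pi\in C$, and let $\operatorname{proj}_{C_1\cap C_2}$ be the metric projection onto $C_1\cap C_2$.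 Then $\mathcal X$ is nonempty, and there exist $\epsilon>0$ and $\tau>0$ such that for every $\pi\in\mathbb{R}^{n\times m}$ with $$\bigl\|\pi-\operatorname{proj}_{C_1\cap C_2}(\pi+D_X\pi D_Y)\bigr\|\le\epsilon$$ one has $$\operatorname{dist}(\pi,\mathcal X)\le\tau\,\bigl\|\pi-\operatorname{proj}_{C_1\cap C_2}(\pi+D_X\pi D_Y)\bigr\|,$$ where $\operatorname{dist}(\pi,\mathcal X)=\inf_{x\in\mathcal X}\|\pi-x\|$. -/

import Mathlib

open scoped Matrix Matrix.Norms.Frobenius Pointwise Gradient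

namespace GW

/-- The Frobenius inner product `⟪A, B⟫ = Tr(Aᵀ B) = ∑ i j, A i j * B i j`; its norm is Mathlib's
Frobenius norm. -/
noncomputable instance frobeniusInnerProductSpace {n m : ℕ} :
    InnerProductSpace ℝ (Matrix (Fin n) (Fin m) ℝ) where
  inner A B := (Aᵀ * B).trace
  norm_sq_eq_re_inner A := by
    have h0 : (0 : ℝ) ≤ ∑ i, ∑ j, A i j ^ 2 :=
      Finset.sum_nonneg fun i _ => Finset.sum_nonneg fun j _ => sq_nonneg _
    have h1 : ‖A‖ ^ 2 = ∑ i, ∑ j, A i j ^ 2 := by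
      rw [Matrix.frobenius_norm_def, ← Real.sqrt_eq_rpow]
      simp only [Real.rpow_two, Real.norm_eq_abs, sq_abs]
      exact Real.sq_sqrt h0
    rw [h1, Finset.sum_comm]
    simp [Matrix.trace, Matrix.mul_apply, sq]
  conj_inner_symm A B := by
    simp only [conj_trivial]
    rw [← Matrix.trace_transpose, Matrix.transpose_mul, Matrix.transpose_transpose]
  add_left A B C := by
    rw [Matrix.transpose_add, Matrix.add_mul, Matrix.trace_add]
  smul_left A B r := by
    simp only [conj_trivial, Matrix.transpose_smul, Matrix.smul_mul, Matrix.trace_smul,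
      smul_eq_mul]

section InnerProduct

variable {E : Type*} [NormedAddCommGroup E] [InnerProductSpace ℝ E]

/-- The normal cone to a convex set `C` at `x` (empty if `x ∉ C`). -/
def normalCone (C : Set E) (x : E) : Set E :=
  {g | x ∈ C ∧ ∀ y ∈ C, inner ℝ g (y - x) ≤ 0}

/-- `p` is a point of `C` nearest to `x`. -/
def IsProj (C : Set E) (x p : E) : Prop :=
  p ∈ C ∧ ∀ y ∈ C, ‖x - p‖ ≤ ‖x - y‖

/-- The metric projection onto `C`: the nearest point of `C`, which exists and is unique if `C` is
nonempty, complete and convex (`isProj_proj`, `IsProj.eq_proj`). -/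
noncomputable def proj (C : Set E) (x : E) : E :=
  Classical.epsilon (IsProj C x)

theorem isProj_proj {C : Set E} (hne : C.Nonempty) (hC : IsComplete C) (hconv : Convex ℝ C)
    (x : E) : IsProj C x (proj C x) := by
  refine Classical.epsilon_spec (p := IsProj C x) ?_
  obtain ⟨p, hp, h⟩ := exists_norm_eq_iInf_of_complete_convex hne hC hconv x
  refine ⟨p, hp, fun y hy => ?_⟩
  rw [h]
  exact ciInf_le ⟨0, by rintro _ ⟨w, rfl⟩; exact norm_nonneg _⟩ (⟨y, hy⟩ : C)

theorem IsProj.inner_le_zero {C : Set E} (hconv : Convex ℝ C) {x p : E} (h : IsProj C x p) :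
    ∀ y ∈ C, inner ℝ (x - p) (y - p) ≤ 0 := by
  refine (norm_eq_iInf_iff_real_inner_le_zero hconv h.1).1 (le_antisymm ?_ ?_)
  · have : Nonempty C := ⟨⟨p, h.1⟩⟩
    exact le_ciInf fun w => h.2 w w.2
  · exact ciInf_le ⟨0, by rintro _ ⟨w, rfl⟩; exact norm_nonneg _⟩ (⟨p, h.1⟩ : C)

theorem IsProj.eq_proj {C : Set E} (hC : IsComplete C) (hconv : Convex ℝ C) {x p : E}
    (h : IsProj C x p) : p = proj C x := by
  have h' := isProj_proj ⟨p, h.1⟩ hC hconv x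
  have h1 := h.inner_le_zero hconv _ h'.1
  have h2 := h'.inner_le_zero hconv _ h.1
  have h3 : inner ℝ (p - proj C x) (p - proj C x) ≤ 0 := by
    have e : inner ℝ (p - proj C x) (p - proj C x)
        = inner ℝ (x - p) (proj C x - p) + inner ℝ (x - proj C x) (p - proj C x) := by
      rw [← neg_sub p (proj C x), inner_neg_right, ← sub_eq_neg_add, ← inner_sub_left]
      congr 1
      abel
    linarith
  exact sub_eq_zero.1 (real_inner_self_nonpos.1 h3)

end InnerProduct

/-- The row constraint set `{π ≥ 0 : π 1_m = μ}`. -/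
def C₁ {n : ℕ} (m : ℕ) (μ : Fin n → ℝ) : Set (Matrix (Fin n) (Fin m) ℝ) :=
  {π | (∀ i j, 0 ≤ π i j) ∧ π *ᵥ 1 = μ}

/-- The column constraint set `{π ≥ 0 : πᵀ 1_n = ν}`. -/
def C₂ (n : ℕ) {m : ℕ} (ν : Fin m → ℝ) : Set (Matrix (Fin n) (Fin m) ℝ) :=
  {π | (∀ i j, 0 ≤ π i j) ∧ πᵀ *ᵥ 1 = ν}

/-- The objective `f(π) = -Tr(D_X π D_Y πᵀ)`. -/
noncomputable def objective {n m : ℕ} (DX : Matrix (Fin n) (Fin n) ℝ)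
    (DY : Matrix (Fin m) (Fin m) ℝ) (π : Matrix (Fin n) (Fin m) ℝ) : ℝ :=
  -(DX * π * DY * πᵀ).trace

/-- The critical point set
`{π ∈ C₁ ∩ C₂ : 0 ∈ ∇f(π) + N_{C₁}(π) + N_{C₂}(π)}`. -/
def criticalSet {n m : ℕ} (DX : Matrix (Fin n) (Fin n) ℝ) (DY : Matrix (Fin m) (Fin m) ℝ)
    (μ : Fin n → ℝ) (ν : Fin m → ℝ) : Set (Matrix (Fin n) (Fin m) ℝ) :=
  {π | π ∈ C₁ m μ ∩ C₂ n ν ∧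
    0 ∈ {∇ (objective DX DY) π} + normalCone (C₁ m μ) π + normalCone (C₂ n ν) π}

/-- The residual `‖π - proj_{C₁ ∩ C₂}(π + D_X π D_Y)‖`. -/
noncomputable def residual {n m : ℕ} (DX : Matrix (Fin n) (Fin n) ℝ)
    (DY : Matrix (Fin m) (Fin m) ℝ) (μ : Fin n → ℝ) (ν : Fin m → ℝ)
    (π : Matrix (Fin n) (Fin m) ℝ) : ℝ :=
  ‖π - proj (C₁ m μ ∩ C₂ n ν) (π + DX * π * DY)‖

end GW

/-! Write `A π = D_X π D_Y`, so that `∇f = -2A`. If `p` is the projection of `π + A π`, then `π + A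
π - p` is normal to the polytope at `p`, and it equals `A p + d` with `d = (A + id)(π - p)`. So `p`
solves the criticality condition up to an error `d` of the size of the residual, and it suffices to
bound the distance from `p` to the critical set by a multiple of `‖d‖`.

Normal vectors have the form `u 1ᵀ + 1 vᵀ - l` with `l ≥ 0` supported where `p` vanishes
(`exists_multipliers`). Once the zero pattern `I` is fixed, complementarity becomes linear: `p = 0`
on `I`, `l = 0` off `I`. The KKT conditions then form a linear system over a cone cut out by
coordinate sign conditions, and a Hoffman-type bound (`BoxConnected.exists_error_bound`) applies.
Convexity of `f` is not needed. There are finitely many patterns, so the constants are uniform. A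
pattern whose system is unsolvable has residual bounded away from zero, which is why the bound is
only local. -/

namespace GW

/-! ### Hoffman-type error bounds over sets closed under coordinate boxes -/

section ErrorBound

open Filter Topology Set

variable {ι : Type*} {F : Type*} [NormedAddCommGroup F] [NormedSpace ℝ F]

/-- The closed cone of vectors whose coordinates have the prescribed sign or vanish. -/
def signCone (s : ι → SignType) : Set (ι → ℝ) :=
  {w | ∀ i, 0 ≤ (s i : ℝ) * w i ∧ (s i = 0 → w i = 0)}

theorem isClosed_signCone (s : ι → SignType) : IsClosed (signCone s) := by
  simp only [signCone, ofPred_forall, ofPred_and]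
  refine isClosed_iInter fun i => IsClosed.inter ?_ ?_
  · exact isClosed_le continuous_const (by fun_prop)
  · exact isClosed_iInter fun _ => isClosed_eq (by fun_prop) continuous_const

theorem smul_mem_signCone {s : ι → SignType} {w : ι → ℝ} (hw : w ∈ signCone s) {t : ℝ}
    (ht : 0 ≤ t) : t • w ∈ signCone s := fun i =>
  ⟨by
    have := mul_nonneg ht (hw i).1
    simp only [Pi.smul_apply, smul_eq_mul]
    linarith, fun h => by simp [(hw i).2 h]⟩

variable [Fintype ι]

/-- A linear map that is injective at the origin of a sign cone is bounded below on it. -/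
theorem exists_bound_on_signCone (T : (ι → ℝ) →ₗ[ℝ] F) (s : ι → SignType)
    (hs : ∀ k ∈ signCone s, T k = 0 → k = 0) :
    ∃ c : ℝ, ∀ w ∈ signCone s, ‖w‖ ≤ c * ‖T w‖ := by
  have hT : Continuous T := T.continuous_of_finiteDimensional
  have hK : IsCompact (Metric.sphere (0 : ι → ℝ) 1 ∩ signCone s) :=
    (isCompact_sphere _ _).inter_right (isClosed_signCone s)
  -- The intersection is empty exactly when the cone is `{0}`, and then any constant works.
  rcases (Metric.sphere (0 : ι → ℝ) 1 ∩ signCone s).eq_empty_or_nonempty with he | hne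
  · refine ⟨0, fun w hw => ?_⟩
    by_contra hlt
    have h0 : 0 < ‖w‖ := by simpa using hlt
    have : ‖w‖⁻¹ • w ∈ Metric.sphere (0 : ι → ℝ) 1 ∩ signCone s :=
      ⟨by simp [norm_smul, h0.ne'], smul_mem_signCone hw (by positivity)⟩
    rw [he] at this
    exact this
  · obtain ⟨k, ⟨hk1, hk2⟩, hmin⟩ := hK.exists_isMinOn hne (hT.norm.continuousOn)
    have hTk : 0 < ‖T k‖ := by
      rw [norm_pos_iff]
      intro h
      have := hs k hk2 h
      simp [this] at hk1
    refine ⟨‖T k‖⁻¹, fun w hw => ?_⟩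
    by_cases h0 : w = 0
    · simp [h0]
    have hpos : 0 < ‖w‖ := norm_pos_iff.2 h0
    have hm : ‖w‖⁻¹ • w ∈ Metric.sphere (0 : ι → ℝ) 1 ∩ signCone s :=
      ⟨by simp [norm_smul, hpos.ne'], smul_mem_signCone hw (by positivity)⟩
    have h1 : ‖T k‖ ≤ ‖T (‖w‖⁻¹ • w)‖ := hmin hm
    rw [map_smul, norm_smul, norm_inv, norm_norm, ← div_eq_inv_mul, le_div_iff₀ hpos] at h1
    rw [← div_eq_inv_mul, le_div_iff₀ hTk]
    linarith

/-- A vector in the sign cone of `w` can be subtracted from `w` in a small amount, which lowers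
all absolute values. -/
theorem exists_pos_abs_sub_smul_le (w k : ι → ℝ) (hk : k ∈ signCone fun i => SignType.sign (w i)) :
    ∃ t : ℝ, 0 < t ∧ ∀ i, w i - t * k i ∈ uIcc 0 (w i) ∧
      |w i - t * k i| = |w i| - t * |k i| := by
  have key : ∀ i, ∀ᶠ t in 𝓝[>] (0 : ℝ), w i - t * k i ∈ uIcc 0 (w i) ∧
      |w i - t * k i| = |w i| - t * |k i| := by
    intro i
    have hki := hk i
    have hc : Tendsto (fun t : ℝ => w i - t * k i) (𝓝[>] 0) (𝓝 (w i)) := by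
      have : Continuous fun t : ℝ => w i - t * k i := by fun_prop
      simpa using (this.tendsto 0).mono_left nhdsWithin_le_nhds
    rcases lt_trichotomy (w i) 0 with h | h | h
    · filter_upwards [hc.eventually (gt_mem_nhds h), self_mem_nhdsWithin] with t ht1 ht2
      have hk0 : k i ≤ 0 := by simpa [sign_neg h] using hki.1
      have : t * k i ≤ 0 := mul_nonpos_of_nonneg_of_nonpos (le_of_lt ht2) hk0
      rw [uIcc_of_ge h.le, abs_of_neg ht1, abs_of_neg h, abs_of_nonpos hk0]
      exact ⟨⟨by linarith, ht1.le⟩, by ring⟩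
    · have hk0 : k i = 0 := hki.2 (by simp [h])
      simp [h, hk0]
    · filter_upwards [hc.eventually (lt_mem_nhds h), self_mem_nhdsWithin] with t ht1 ht2
      have hk0 : 0 ≤ k i := by simpa [sign_pos h] using hki.1
      have : 0 ≤ t * k i := mul_nonneg (le_of_lt ht2) hk0
      rw [uIcc_of_le h.le, abs_of_pos ht1, abs_of_pos h, abs_of_nonneg hk0]
      exact ⟨⟨ht1.le, by linarith⟩, by ring⟩
  obtain ⟨t, ht, h0⟩ := ((eventually_all.2 key).and self_mem_nhdsWithin).exists
  exact ⟨t, h0, ht⟩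

/-- Take `w` of least ℓ¹ norm in the box with `T w = T z`. A nonzero kernel vector in the sign cone
of `w` could be subtracted in a small amount, staying in the box and lowering the ℓ¹ norm. So `T` is
injective at the origin of that cone, hence bounded below on it; only finitely many sign patterns
occur. -/
theorem exists_conformal_bound_zero (T : (ι → ℝ) →ₗ[ℝ] F) :
    ∃ c : ℝ, 0 ≤ c ∧ ∀ z : ι → ℝ, ∃ w : ι → ℝ,
      (∀ i, w i ∈ uIcc 0 (z i)) ∧ T w = T z ∧ ‖w‖ ≤ c * ‖T z‖ := by
  have hT : Continuous T := T.continuous_of_finiteDimensional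
  -- The injectivity condition is moved inside, so that a constant (0 by default) exists for every
  -- pattern and a maximum can be taken.
  have hex : ∀ s : ι → SignType, ∃ c : ℝ, (∀ k ∈ signCone s, T k = 0 → k = 0) →
      ∀ w ∈ signCone s, ‖w‖ ≤ c * ‖T w‖ := by
    intro s
    by_cases hs : ∀ k ∈ signCone s, T k = 0 → k = 0
    · obtain ⟨c, hc⟩ := exists_bound_on_signCone T s hs
      exact ⟨c, fun _ => hc⟩
    · exact ⟨0, fun h => absurd h hs⟩
  choose c hc using hex
  obtain ⟨M, hM⟩ := (Set.finite_range c).bddAbove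
  refine ⟨max M 0, le_max_right _ _, fun z => ?_⟩
  set B : Set (ι → ℝ) := (Set.univ.pi fun i => uIcc 0 (z i)) ∩ {w | T w = T z}
  have hB : IsCompact B :=
    (isCompact_univ_pi fun i => isCompact_uIcc).inter_right (isClosed_eq hT continuous_const)
  have hzB : z ∈ B := ⟨fun i _ => right_mem_uIcc, rfl⟩
  obtain ⟨w, ⟨hw1, hw2⟩, hmin⟩ := hB.exists_isMinOn ⟨z, hzB⟩
    (f := fun w => ∑ i, |w i|) (by fun_prop)
  refine ⟨w, fun i => hw1 i trivial, hw2, ?_⟩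
  have hw2 : T w = T z := hw2
  have hinj : ∀ k ∈ signCone (fun i => SignType.sign (w i)), T k = 0 → k = 0 := by
    intro k hk hTk
    obtain ⟨t, ht, h⟩ := exists_pos_abs_sub_smul_le w k hk
    have hmem : w - t • k ∈ B := by
      refine ⟨fun i _ => ?_, ?_⟩
      · exact uIcc_subset_uIcc left_mem_uIcc (hw1 i trivial) (h i).1
      · simp [hTk, hw2]
    have hle : ∑ i, |w i| ≤ ∑ i, |(w - t • k) i| := hmin hmem
    have heq : ∑ i, |(w - t • k) i| = ∑ i, |w i| - t * ∑ i, |k i| := by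
      rw [Finset.mul_sum, ← Finset.sum_sub_distrib]
      exact Finset.sum_congr rfl fun i _ => (h i).2
    have hs0 : ∑ i, |k i| ≤ 0 := by
      by_contra hpos
      have := mul_pos ht (not_le.1 hpos)
      linarith
    have := (Finset.sum_eq_zero_iff_of_nonneg fun i _ => abs_nonneg (k i)).1
      (le_antisymm hs0 (Finset.sum_nonneg fun i _ => abs_nonneg _))
    funext i
    simpa using this i (Finset.mem_univ i)
  have hwmem : w ∈ signCone fun i => SignType.sign (w i) := fun i =>
    ⟨by rw [sign_mul_self]; exact abs_nonneg _, fun h => sign_eq_zero_iff.1 h⟩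
  calc ‖w‖ ≤ c _ * ‖T w‖ := hc _ hinj w hwmem
    _ ≤ max M 0 * ‖T w‖ := by
      gcongr
      exact (hM ⟨_, rfl⟩).trans (le_max_left _ _)
    _ = _ := by rw [hw2]

/-- For a linear map `T` there is a constant `c` such that from any `x` every value `T y` can be
reached inside the coordinate box spanned by `x` and `y` by a step of size at most
`c * ‖T y - T x‖`. -/
theorem exists_conformal_bound (T : (ι → ℝ) →ₗ[ℝ] F) :
    ∃ c : ℝ, 0 ≤ c ∧ ∀ x y : ι → ℝ, ∃ w : ι → ℝ,
      (∀ i, w i ∈ uIcc (x i) (y i)) ∧ T w = T y ∧ ‖w - x‖ ≤ c * ‖T y - T x‖ := by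
  obtain ⟨c, hc, h⟩ := exists_conformal_bound_zero T
  refine ⟨c, hc, fun x y => ?_⟩
  obtain ⟨w, h1, h2, h3⟩ := h (y - x)
  refine ⟨x + w, fun i => ?_, by rw [map_add, h2, map_sub]; abel, by
    rw [add_sub_cancel_left, ← map_sub]; exact h3⟩
  have := h1 i
  simp only [mem_uIcc, Pi.sub_apply, Pi.add_apply] at this ⊢
  rcases this with ⟨ha, hb⟩ | ⟨ha, hb⟩
  · exact Or.inl ⟨by linarith, by linarith⟩
  · exact Or.inr ⟨by linarith, by linarith⟩

/-- `O` contains the coordinate box spanned by any two of its points. -/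
def BoxConnected (O : Set (ι → ℝ)) : Prop :=
  ∀ x ∈ O, ∀ y ∈ O, ∀ w : ι → ℝ, (∀ i, w i ∈ uIcc (x i) (y i)) → w ∈ O

/-- A convergent, hence bounded, sequence of values has bounded preimages: the conformal bound from
`0` shrinks each preimage without leaving `O`. Compactness then gives the limit. -/
theorem BoxConnected.isClosed_image {O : Set (ι → ℝ)} (hO : BoxConnected O) (hcl : IsClosed O)
    (h0 : 0 ∈ O) (T : (ι → ℝ) →ₗ[ℝ] F) : IsClosed (T '' O) := by
  have hT : Continuous T := T.continuous_of_finiteDimensional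
  obtain ⟨c, hc, hconf⟩ := exists_conformal_bound T
  refine IsSeqClosed.isClosed fun b b' hb hlim => ?_
  obtain ⟨R, hR⟩ := (Metric.isBounded_range_of_tendsto b hlim).exists_norm_le
  have hcpt : IsCompact (T '' (Metric.closedBall 0 (c * R) ∩ O)) :=
    ((isCompact_closedBall _ _).inter_right hcl).image hT
  refine image_mono inter_subset_right
    (hcpt.isClosed.mem_of_tendsto hlim (Eventually.of_forall fun k => ?_))
  obtain ⟨y, hy, hyb⟩ := hb k
  obtain ⟨w, h1, h2, h3⟩ := hconf 0 y
  refine ⟨w, ⟨?_, hO 0 h0 y hy w h1⟩, by rw [h2, hyb]⟩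
  rw [mem_closedBall_zero_iff]
  rw [sub_zero, map_zero, sub_zero, hyb] at h3
  exact h3.trans (mul_le_mul_of_nonneg_left (hR _ ⟨k, rfl⟩) hc)

/-- Local error bound for the system `x ∈ O`, `T x = b`, which need not be solvable. -/
theorem BoxConnected.exists_error_bound {O : Set (ι → ℝ)} (hO : BoxConnected O)
    (hcl : IsClosed O) (h0 : 0 ∈ O) (T : (ι → ℝ) →ₗ[ℝ] F) (b : F) :
    ∃ ε : ℝ, 0 < ε ∧ ∃ τ : ℝ, ∀ x ∈ O, ‖T x - b‖ ≤ ε →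
      ∃ y ∈ O, T y = b ∧ ‖x - y‖ ≤ τ * ‖T x - b‖ := by
  -- If `b` is attained, the conformal bound gives the estimate at any distance. Otherwise `b` has
  -- positive distance from the closed image, and a small `ε` makes the claim vacuous.
  by_cases hb : b ∈ T '' O
  · obtain ⟨z, hz, rfl⟩ := hb
    obtain ⟨c, -, hconf⟩ := exists_conformal_bound T
    refine ⟨1, one_pos, c, fun x hx _ => ?_⟩
    obtain ⟨w, h1, h2, h3⟩ := hconf x z
    exact ⟨w, hO x hx z hz w h1, h2, by rwa [norm_sub_rev, norm_sub_rev (T x)]⟩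
  · obtain ⟨ε, hε, hball⟩ := Metric.isOpen_iff.1
      (hO.isClosed_image hcl h0 T).isOpen_compl b hb
    refine ⟨ε / 2, half_pos hε, 0, fun x hx hle => ?_⟩
    refine absurd (mem_image_of_mem T hx) (hball ?_)
    rw [mem_ball_iff_norm]
    linarith

end ErrorBound

/-! ### The transport polytope and its normal cones -/

section Transport

open Filter Topology Set

variable {n m : ℕ}

theorem inner_eq_sum (A B : Matrix (Fin n) (Fin m) ℝ) :
    inner ℝ A B = ∑ i, ∑ j, A i j * B i j := by
  change (Aᵀ * B).trace = _
  rw [Finset.sum_comm]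
  simp [Matrix.trace, Matrix.mul_apply]

theorem mem_C₁_iff {μ : Fin n → ℝ} {π : Matrix (Fin n) (Fin m) ℝ} :
    π ∈ C₁ m μ ↔ (∀ i j, 0 ≤ π i j) ∧ ∀ i, ∑ j, π i j = μ i := by
  simp [C₁, funext_iff, Matrix.mulVec, dotProduct]

theorem mem_C₂_iff {ν : Fin m → ℝ} {π : Matrix (Fin n) (Fin m) ℝ} :
    π ∈ C₂ n ν ↔ (∀ i j, 0 ≤ π i j) ∧ ∀ j, ∑ i, π i j = ν j := by
  simp [C₂, funext_iff, Matrix.mulVec, dotProduct]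

theorem mem_couplings_iff {μ : Fin n → ℝ} {ν : Fin m → ℝ} {π : Matrix (Fin n) (Fin m) ℝ} :
    π ∈ C₁ m μ ∩ C₂ n ν ↔
      (∀ i j, 0 ≤ π i j) ∧ (∀ i, ∑ j, π i j = μ i) ∧ ∀ j, ∑ i, π i j = ν j := by
  rw [mem_inter_iff, mem_C₁_iff, mem_C₂_iff]
  tauto

theorem convex_couplings (μ : Fin n → ℝ) (ν : Fin m → ℝ) :
    Convex ℝ (C₁ m μ ∩ C₂ n ν) := by
  intro x hx y hy a b ha hb hab
  rw [mem_couplings_iff] at *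
  obtain ⟨hx0, hx1, hx2⟩ := hx
  obtain ⟨hy0, hy1, hy2⟩ := hy
  refine ⟨fun i j => ?_, fun i => ?_, fun j => ?_⟩
  · exact add_nonneg (mul_nonneg ha (hx0 i j)) (mul_nonneg hb (hy0 i j))
  · simp only [Matrix.add_apply, Matrix.smul_apply, smul_eq_mul, Finset.sum_add_distrib,
      ← Finset.mul_sum, hx1, hy1]
    rw [← add_mul, hab, one_mul]
  · simp only [Matrix.add_apply, Matrix.smul_apply, smul_eq_mul, Finset.sum_add_distrib,
      ← Finset.mul_sum, hx2, hy2]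
    rw [← add_mul, hab, one_mul]

theorem couplings_nonempty {μ : Fin n → ℝ} (hμ : μ ∈ stdSimplex ℝ (Fin n)) {ν : Fin m → ℝ}
    (hν : ν ∈ stdSimplex ℝ (Fin m)) : (C₁ m μ ∩ C₂ n ν).Nonempty := by
  refine ⟨Matrix.of fun i j => μ i * ν j, mem_couplings_iff.2 ⟨fun i j => ?_, fun i => ?_,
    fun j => ?_⟩⟩
  · exact mul_nonneg (hμ.1 i) (hν.1 j)
  · simp [← Finset.mul_sum, hν.2]
  · simp [← Finset.sum_mul, hμ.2]

theorem isClosed_couplings (μ : Fin n → ℝ) (ν : Fin m → ℝ) :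
    IsClosed (C₁ m μ ∩ C₂ n ν) := by
  have : C₁ m μ ∩ C₂ n ν = {π | (∀ i j, 0 ≤ π i j) ∧ (∀ i, ∑ j, π i j = μ i) ∧
      ∀ j, ∑ i, π i j = ν j} := Set.ext fun _ => mem_couplings_iff
  rw [this]
  simp only [ofPred_forall, ofPred_and]
  refine IsClosed.inter ?_ (IsClosed.inter ?_ ?_)
  · exact isClosed_iInter fun i => isClosed_iInter fun j =>
      isClosed_le continuous_const (by fun_prop)
  · exact isClosed_iInter fun i => isClosed_eq (by fun_prop) continuous_const
  · exact isClosed_iInter fun i => isClosed_eq (by fun_prop) continuous_const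

theorem isCompact_couplings (μ : Fin n → ℝ) (ν : Fin m → ℝ) :
    IsCompact (C₁ m μ ∩ C₂ n ν) := by
  have hbox : IsCompact {π : Matrix (Fin n) (Fin m) ℝ | ∀ i, π i ∈
      {r : Fin m → ℝ | ∀ j, r j ∈ Icc 0 (μ i)}} :=
    isCompact_pi_infinite fun i => isCompact_pi_infinite fun _ => isCompact_Icc
  refine hbox.of_isClosed_subset (isClosed_couplings μ ν) fun π hπ => ?_
  obtain ⟨h0, h1, -⟩ := mem_couplings_iff.1 hπ
  exact fun i j => ⟨h0 i j, h1 i ▸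
    Finset.single_le_sum (fun k _ => h0 i k) (Finset.mem_univ j)⟩

/-- Index type of the multipliers `(u, v, l)` of the row, column and sign constraints. -/
abbrev MultIdx (n m : ℕ) : Type := Fin n ⊕ Fin m ⊕ (Fin n × Fin m)

/-- The matrix `u 1ᵀ + 1 vᵀ - l` of the multipliers `(u, v, l)`. -/
def multMap (n m : ℕ) : (MultIdx n m → ℝ) →ₗ[ℝ] Matrix (Fin n) (Fin m) ℝ where
  toFun x := Matrix.of fun i j => x (.inl i) + x (.inr (.inl j)) - x (.inr (.inr (i, j)))
  map_add' x y := by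
    ext i j
    simp only [Matrix.of_apply, Matrix.add_apply, Pi.add_apply]
    ring
  map_smul' r x := by
    ext i j
    simp only [Matrix.of_apply, Matrix.smul_apply, Pi.smul_apply, smul_eq_mul, RingHom.id_apply]
    ring

theorem multMap_apply (x : MultIdx n m → ℝ) (i : Fin n) (j : Fin m) :
    multMap n m x i j = x (.inl i) + x (.inr (.inl j)) - x (.inr (.inr (i, j))) := rfl

/-- The multipliers whose sign part is nonnegative and supported in `I`. -/
def multCone (I : Set (Fin n × Fin m)) : Set (MultIdx n m → ℝ) :=
  {x | ∀ q, 0 ≤ x (.inr (.inr q)) ∧ (q ∉ I → x (.inr (.inr q)) = 0)}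

theorem uIcc_nonneg {a b c : ℝ} (ha : 0 ≤ a) (hb : 0 ≤ b) (hc : c ∈ uIcc a b) : 0 ≤ c :=
  (le_min ha hb).trans hc.1

theorem uIcc_eq_zero {a b c : ℝ} (ha : a = 0) (hb : b = 0) (hc : c ∈ uIcc a b) : c = 0 := by
  simpa [ha, hb] using hc

theorem boxConnected_multCone (I : Set (Fin n × Fin m)) : BoxConnected (multCone I) :=
  fun _ hx _ hy _ hw q => ⟨uIcc_nonneg (hx q).1 (hy q).1 (hw _),
    fun h => uIcc_eq_zero ((hx q).2 h) ((hy q).2 h) (hw _)⟩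

theorem isClosed_multCone (I : Set (Fin n × Fin m)) : IsClosed (multCone I) := by
  simp only [multCone, ofPred_forall, ofPred_and]
  refine isClosed_iInter fun q => IsClosed.inter ?_ ?_
  · exact isClosed_le continuous_const (by fun_prop)
  · exact isClosed_iInter fun _ => isClosed_eq (by fun_prop) continuous_const

theorem zero_mem_multCone (I : Set (Fin n × Fin m)) : 0 ∈ multCone I :=
  fun _ => ⟨le_rfl, fun _ => rfl⟩

theorem add_mem_multCone {I : Set (Fin n × Fin m)} {x y : MultIdx n m → ℝ}
    (hx : x ∈ multCone I) (hy : y ∈ multCone I) : x + y ∈ multCone I := fun q =>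
  ⟨add_nonneg (hx q).1 (hy q).1, fun h => by simp [(hx q).2 h, (hy q).2 h]⟩

theorem smul_mem_multCone {I : Set (Fin n × Fin m)} {x : MultIdx n m → ℝ}
    (hx : x ∈ multCone I) {t : ℝ} (ht : 0 ≤ t) : t • x ∈ multCone I := fun q =>
  ⟨mul_nonneg ht (hx q).1, fun h => by simp [(hx q).2 h]⟩

theorem multCone_mono {I J : Set (Fin n × Fin m)} (h : I ⊆ J) : multCone I ⊆ multCone J :=
  fun _ hx q => ⟨(hx q).1, fun hq => (hx q).2 fun hI => hq (h hI)⟩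

theorem convex_image_multCone (I : Set (Fin n × Fin m)) :
    Convex ℝ (multMap n m '' multCone I) :=
  Convex.linear_image (fun _ hx _ hy _ _ ha hb _ =>
    add_mem_multCone (smul_mem_multCone hx ha) (smul_mem_multCone hy hb)) _

/-- A direction that preserves the marginals and is nonnegative where `p` vanishes is feasible. -/
theorem exists_pos_add_smul_mem_couplings {μ : Fin n → ℝ} {ν : Fin m → ℝ}
    {p h : Matrix (Fin n) (Fin m) ℝ} (hp : p ∈ C₁ m μ ∩ C₂ n ν)
    (hrow : ∀ i, ∑ j, h i j = 0) (hcol : ∀ j, ∑ i, h i j = 0)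
    (hpos : ∀ i j, p i j = 0 → 0 ≤ h i j) :
    ∃ t : ℝ, 0 < t ∧ p + t • h ∈ C₁ m μ ∩ C₂ n ν := by
  obtain ⟨h0, h1, h2⟩ := mem_couplings_iff.1 hp
  have key : ∀ i j, ∀ᶠ t in 𝓝[>] (0 : ℝ), 0 ≤ p i j + t * h i j := by
    intro i j
    rcases (h0 i j).eq_or_lt with he | hlt
    · filter_upwards [self_mem_nhdsWithin] with t ht
      rw [← he, zero_add]
      exact mul_nonneg (le_of_lt ht) (hpos i j he.symm)
    · have hc : Continuous fun t : ℝ => p i j + t * h i j := by fun_prop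
      have ht : Tendsto (fun t : ℝ => p i j + t * h i j) (𝓝[>] 0) (𝓝 (p i j)) := by
        simpa using (hc.tendsto 0).mono_left nhdsWithin_le_nhds
      filter_upwards [ht.eventually (lt_mem_nhds hlt)] with t ht using ht.le
  obtain ⟨t, ht, ht0⟩ :=
    ((eventually_all.2 fun i => eventually_all.2 (key i)).and self_mem_nhdsWithin).exists
  refine ⟨t, ht0, mem_couplings_iff.2 ⟨ht, fun i => ?_, fun j => ?_⟩⟩
  · simp [Finset.sum_add_distrib, ← Finset.mul_sum, hrow, h1]
  · simp [Finset.sum_add_distrib, ← Finset.mul_sum, hcol, h2]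

theorem inner_multMap (h : Matrix (Fin n) (Fin m) ℝ) (x : MultIdx n m → ℝ) :
    inner ℝ h (multMap n m x) = ∑ i, x (.inl i) * ∑ j, h i j
      + ∑ j, x (.inr (.inl j)) * ∑ i, h i j - ∑ i, ∑ j, x (.inr (.inr (i, j))) * h i j := by
  rw [inner_eq_sum]
  simp only [Finset.mul_sum]
  rw [Finset.sum_comm (s := Finset.univ (α := Fin m)), ← Finset.sum_add_distrib,
    ← Finset.sum_sub_distrib]
  refine Finset.sum_congr rfl fun i _ => ?_
  rw [← Finset.sum_add_distrib, ← Finset.sum_sub_distrib]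
  refine Finset.sum_congr rfl fun j _ => ?_
  rw [multMap_apply]
  ring

/-- Normal vectors to the transport polytope have multipliers complementary to the base point. -/
theorem exists_multipliers {μ : Fin n → ℝ} {ν : Fin m → ℝ} {p g : Matrix (Fin n) (Fin m) ℝ}
    (hg : g ∈ normalCone (C₁ m μ ∩ C₂ n ν) p) :
    ∃ x ∈ multCone {q | p q.1 q.2 = 0}, multMap n m x = g := by
  obtain ⟨hp, hg⟩ := hg
  set I : Set (Fin n × Fin m) := {q | p q.1 q.2 = 0} with hI
  have hcl : IsClosed (multMap n m '' multCone I) :=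
    (boxConnected_multCone I).isClosed_image (isClosed_multCone I) (zero_mem_multCone I) _
  have hconv := convex_image_multCone I
  -- Farkas' lemma by projection: the remainder `h` of `g` after projecting onto the multiplier cone
  -- lies in the polar cone. This makes `h` a feasible direction at `p`, so `⟪g, h⟫ ≤ 0`, while `⟪g,
  -- h⟫ = ‖h‖²`.
  have hproj := isProj_proj ⟨_, mem_image_of_mem _ (zero_mem_multCone I)⟩ hcl.isComplete hconv g
  have hle := hproj.inner_le_zero hconv
  obtain ⟨x, hx, hxq⟩ := hproj.1
  rw [← hxq] at hle
  refine ⟨x, hx, ?_⟩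
  set h := g - multMap n m x with hh
  have hpolar : ∀ y ∈ multCone I, inner ℝ h (multMap n m y) ≤ 0 := by
    intro y hy
    have := hle _ (mem_image_of_mem _ (add_mem_multCone hx hy))
    rwa [map_add, add_sub_cancel_left] at this
  have horth : inner ℝ h (multMap n m x) = 0 := by
    refine le_antisymm (hpolar x hx) ?_
    have := hle _ (mem_image_of_mem _ (zero_mem_multCone I))
    rw [map_zero, zero_sub, inner_neg_right] at this
    linarith
  have hrow : ∀ i, ∑ j, h i j = 0 := by
    -- The row multipliers are unrestricted in sign; using the row sums themselves makes the pairing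
    -- a sum of squares.
    have := hpolar (Sum.elim (fun i => ∑ j, h i j) 0) fun q => ⟨le_rfl, fun _ => rfl⟩
    rw [inner_multMap] at this
    simp only [Sum.elim_inl, Sum.elim_inr, Pi.zero_apply, zero_mul, Finset.sum_const_zero,
      add_zero, sub_zero] at this
    have h' := (Finset.sum_eq_zero_iff_of_nonneg fun i _ => mul_self_nonneg (∑ j, h i j)).1
      (le_antisymm this (Finset.sum_nonneg fun i _ => mul_self_nonneg _))
    exact fun i => mul_self_eq_zero.1 (h' i (Finset.mem_univ i))
  have hcol : ∀ j, ∑ i, h i j = 0 := by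
    have := hpolar (Sum.elim 0 (Sum.elim (fun j => ∑ i, h i j) 0)) fun q => ⟨le_rfl, fun _ => rfl⟩
    rw [inner_multMap] at this
    simp only [Sum.elim_inl, Sum.elim_inr, Pi.zero_apply, zero_mul, Finset.sum_const_zero,
      zero_add, sub_zero] at this
    have h' := (Finset.sum_eq_zero_iff_of_nonneg fun j _ => mul_self_nonneg (∑ i, h i j)).1
      (le_antisymm this (Finset.sum_nonneg fun i _ => mul_self_nonneg _))
    exact fun i => mul_self_eq_zero.1 (h' i (Finset.mem_univ i))
  have hpos : ∀ i j, p i j = 0 → 0 ≤ h i j := by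
    intro i j hij
    have := hpolar (Sum.elim 0 (Sum.elim 0 (Pi.single (i, j) 1))) fun q => by
      refine ⟨?_, fun hq => ?_⟩
      · exact (Pi.single_nonneg (α := fun _ => ℝ)).2 zero_le_one q
      · exact Pi.single_eq_of_ne (fun e => hq (by rw [e]; exact hij)) _
    rw [inner_multMap, ← Fintype.sum_prod_type' (f := fun a b => _ * h a b)] at this
    simp only [Sum.elim_inl, Sum.elim_inr, Pi.zero_apply, zero_mul, Finset.sum_const_zero,
      zero_add, zero_sub, Prod.mk.eta, Pi.single_apply, ite_mul, one_mul, Finset.sum_ite_eq',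
      Finset.mem_univ, if_true] at this
    linarith
  obtain ⟨t, ht, hmem⟩ := exists_pos_add_smul_mem_couplings hp hrow hcol hpos
  have h1 := hg _ hmem
  rw [add_sub_cancel_left, inner_smul_right] at h1
  have h2 : inner ℝ g h = inner ℝ h h := by
    have : g = h + multMap n m x := by rw [hh]; abel
    rw [this, inner_add_left, real_inner_comm h (multMap n m x), horth, add_zero]
  rw [h2] at h1
  have h3 : inner ℝ h h ≤ 0 := by
    by_contra hlt
    have := mul_pos ht (not_le.1 hlt)
    linarith
  exact (sub_eq_zero.1 (real_inner_self_nonpos.1 h3)).symm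

/-- Both sets impose `π ≥ 0`, so the sign multiplier may go entirely to `C₁`: the splitting is `(u
1ᵀ - l) + 1 vᵀ`. -/
theorem multMap_mem_normalCone_add {μ : Fin n → ℝ} {ν : Fin m → ℝ}
    {p : Matrix (Fin n) (Fin m) ℝ} (hp : p ∈ C₁ m μ ∩ C₂ n ν) {x : MultIdx n m → ℝ}
    (hx : x ∈ multCone {q | p q.1 q.2 = 0}) :
    multMap n m x ∈ normalCone (C₁ m μ) p + normalCone (C₂ n ν) p := by
  have hrow := (mem_C₁_iff.1 hp.1).2
  have hcol := (mem_C₂_iff.1 hp.2).2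
  refine ⟨multMap n m (Sum.elim (fun i => x (.inl i)) (Sum.elim 0 fun q => x (.inr (.inr q)))),
    ⟨hp.1, fun y hy => ?_⟩, multMap n m (Sum.elim 0 (Sum.elim (fun j => x (.inr (.inl j))) 0)),
    ⟨hp.2, fun y hy => ?_⟩, ?_⟩
  · rw [mem_C₁_iff] at hy
    rw [real_inner_comm, inner_multMap]
    simp only [Sum.elim_inl, Sum.elim_inr, Pi.zero_apply, zero_mul, Finset.sum_const_zero,
      add_zero, Matrix.sub_apply, Finset.sum_sub_distrib, hrow, hy.2, sub_self, mul_zero, zero_sub,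
      neg_nonpos]
    refine Finset.sum_nonneg fun i _ => Finset.sum_nonneg fun j _ => ?_
    by_cases hij : p i j = 0
    · rw [hij, sub_zero]
      exact mul_nonneg (hx (i, j)).1 (hy.1 i j)
    · rw [(hx (i, j)).2 hij, zero_mul]
  · rw [mem_C₂_iff] at hy
    rw [real_inner_comm, inner_multMap]
    simp [Finset.sum_sub_distrib, hcol, hy.2]
  · ext i j
    simp only [Matrix.add_apply, multMap_apply, Sum.elim_inl, Sum.elim_inr, Pi.zero_apply]
    ring

end Transport

/-! ### Operator bounds and the gradient of a quadratic form -/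

theorem exists_norm_le_mul_norm {E F : Type*} [NormedAddCommGroup E] [NormedSpace ℝ E]
    [FiniteDimensional ℝ E] [NormedAddCommGroup F] [NormedSpace ℝ F] (L : E →ₗ[ℝ] F) :
    ∃ K : ℝ, 0 ≤ K ∧ ∀ x, ‖L x‖ ≤ K * ‖x‖ :=
  ⟨‖LinearMap.toContinuousLinearMap L‖, norm_nonneg _,
    (LinearMap.toContinuousLinearMap L).le_opNorm⟩

theorem hasGradientAt_neg_quadratic {E : Type*} [NormedAddCommGroup E] [InnerProductSpace ℝ E]
    [FiniteDimensional ℝ E] [CompleteSpace E] (A : E →ₗ[ℝ] E)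
    (hA : ∀ x y, inner ℝ (A x) y = inner ℝ x (A y)) (x : E) :
    HasGradientAt (fun x => -inner ℝ x (A x)) (-(2 : ℝ) • A x) x := by
  rw [hasGradientAt_iff_hasFDerivAt]
  have h := ((hasFDerivAt_id x).inner ℝ (LinearMap.toContinuousLinearMap A).hasFDerivAt).neg
  refine h.congr_fderiv ?_
  ext y
  simp only [InnerProductSpace.toDual_apply_apply, inner_smul_left, neg_apply,
    ContinuousLinearMap.comp_apply, ContinuousLinearMap.prod_apply, fderivInnerCLM_apply,
    ContinuousLinearMap.id_apply, id, conj_trivial, LinearMap.coe_toContinuousLinearMap']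
  rw [← hA x y, real_inner_comm y (A x)]
  ring

/-! ### Critical points through multipliers -/

section Critical

open Filter Topology Set

variable {n m : ℕ}

/-- The linear map `π ↦ D_X π D_Y`. -/
def sandwich (DX : Matrix (Fin n) (Fin n) ℝ) (DY : Matrix (Fin m) (Fin m) ℝ) :
    Matrix (Fin n) (Fin m) ℝ →ₗ[ℝ] Matrix (Fin n) (Fin m) ℝ where
  toFun π := DX * π * DY
  map_add' x y := by rw [Matrix.mul_add, Matrix.add_mul]
  map_smul' r x := by rw [Matrix.mul_smul, Matrix.smul_mul, RingHom.id_apply]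

theorem sandwich_apply (DX : Matrix (Fin n) (Fin n) ℝ) (DY : Matrix (Fin m) (Fin m) ℝ)
    (π : Matrix (Fin n) (Fin m) ℝ) : sandwich DX DY π = DX * π * DY := rfl

theorem inner_sandwich_comm {DX : Matrix (Fin n) (Fin n) ℝ} (hDX : DX.IsSymm)
    {DY : Matrix (Fin m) (Fin m) ℝ} (hDY : DY.IsSymm) (x y : Matrix (Fin n) (Fin m) ℝ) :
    inner ℝ (sandwich DX DY x) y = inner ℝ x (sandwich DX DY y) := by
  change ((DX * x * DY)ᵀ * y).trace = (xᵀ * (DX * y * DY)).trace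
  rw [Matrix.transpose_mul, Matrix.transpose_mul, hDX.eq, hDY.eq, Matrix.mul_assoc,
    Matrix.trace_mul_comm]
  simp only [Matrix.mul_assoc]

theorem objective_eq_inner (DX : Matrix (Fin n) (Fin n) ℝ) (DY : Matrix (Fin m) (Fin m) ℝ)
    (π : Matrix (Fin n) (Fin m) ℝ) : objective DX DY π = -inner ℝ π (sandwich DX DY π) := by
  change -(DX * π * DY * πᵀ).trace = -(πᵀ * (DX * π * DY)).trace
  rw [Matrix.trace_mul_comm]

theorem hasGradientAt_objective {DX : Matrix (Fin n) (Fin n) ℝ} (hDX : DX.IsSymm)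
    {DY : Matrix (Fin m) (Fin m) ℝ} (hDY : DY.IsSymm) (π : Matrix (Fin n) (Fin m) ℝ) :
    HasGradientAt (objective DX DY) (-(2 : ℝ) • sandwich DX DY π) π := by
  rw [show objective DX DY = fun x => -inner ℝ x (sandwich DX DY x) from
    funext fun x => objective_eq_inner DX DY x]
  exact hasGradientAt_neg_quadratic _ (inner_sandwich_comm hDX hDY) π

theorem mem_criticalSet {DX : Matrix (Fin n) (Fin n) ℝ} (hDX : DX.IsSymm)
    {DY : Matrix (Fin m) (Fin m) ℝ} (hDY : DY.IsSymm) {μ : Fin n → ℝ} {ν : Fin m → ℝ}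
    {p : Matrix (Fin n) (Fin m) ℝ} (hp : p ∈ C₁ m μ ∩ C₂ n ν) {x : MultIdx n m → ℝ}
    (hx : x ∈ multCone {q | p q.1 q.2 = 0}) (h : multMap n m x = sandwich DX DY p) :
    p ∈ criticalSet DX DY μ ν := by
  refine ⟨hp, ?_⟩
  -- The gradient is `-2 A p`; doubling the multipliers stays in the cone and cancels it.
  rw [(hasGradientAt_objective hDX hDY p).gradient, add_assoc, singleton_add]
  refine ⟨_, multMap_mem_normalCone_add hp (smul_mem_multCone hx (zero_le_two (α := ℝ))), ?_⟩
  rw [map_smul, h, neg_smul]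
  exact neg_add_cancel _

/-- A global minimiser exists by compactness, and its first-order condition on the convex polytope
puts `A p` in the normal cone. -/
theorem criticalSet_nonempty {DX : Matrix (Fin n) (Fin n) ℝ} (hDX : DX.IsSymm)
    {DY : Matrix (Fin m) (Fin m) ℝ} (hDY : DY.IsSymm) {μ : Fin n → ℝ}
    (hμ : μ ∈ stdSimplex ℝ (Fin n)) {ν : Fin m → ℝ} (hν : ν ∈ stdSimplex ℝ (Fin m)) :
    (criticalSet DX DY μ ν).Nonempty := by
  have hf : Continuous (objective DX DY) := continuous_iff_continuousAt.2 fun x =>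
    (hasGradientAt_objective hDX hDY x).continuousAt
  obtain ⟨p, hp, hmin⟩ := (isCompact_couplings μ ν).exists_isMinOn (couplings_nonempty hμ hν)
    hf.continuousOn
  have hd := (hasGradientAt_objective hDX hDY p).hasFDerivAt
  have hnormal : sandwich DX DY p ∈ normalCone (C₁ m μ ∩ C₂ n ν) p := by
    refine ⟨hp, fun y hy => ?_⟩
    have := (hmin.localize).hasFDerivWithinAt_nonneg hd.hasFDerivWithinAt
      (sub_mem_posTangentConeAt_of_segment_subset ((convex_couplings μ ν).segment_subset hp hy))
    rw [InnerProductSpace.toDual_apply_apply, inner_smul_left, conj_trivial] at this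
    linarith
  obtain ⟨x, hx, h⟩ := exists_multipliers hnormal
  exact ⟨p, mem_criticalSet hDX hDY hp hx h⟩

/-! ### The KKT system with a fixed zero pattern -/

/-- Index type of the primal-dual variables `(p, u, v, l)`. -/
abbrev KKTIdx (n m : ℕ) : Type := (Fin n × Fin m) ⊕ MultIdx n m

/-- The primal part of the primal-dual variables. -/
def primal (n m : ℕ) : (KKTIdx n m → ℝ) →ₗ[ℝ] Matrix (Fin n) (Fin m) ℝ where
  toFun z := Matrix.of fun i j => z (.inl (i, j))
  map_add' _ _ := rfl
  map_smul' _ _ := rfl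

/-- The multiplier part of the primal-dual variables. -/
def dual (n m : ℕ) : (KKTIdx n m → ℝ) →ₗ[ℝ] (MultIdx n m → ℝ) :=
  LinearMap.funLeft ℝ ℝ Sum.inr

/-- The linear map of the marginal and stationarity conditions. -/
def kktMap (DX : Matrix (Fin n) (Fin n) ℝ) (DY : Matrix (Fin m) (Fin m) ℝ) :
    (KKTIdx n m → ℝ) →ₗ[ℝ] (Fin n → ℝ) × (Fin m → ℝ) × Matrix (Fin n) (Fin m) ℝ :=
  LinearMap.prod ((Matrix.mulVecBilin ℝ ℝ).flip 1 ∘ₗ primal n m) (LinearMap.prod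
    (Matrix.vecMulBilin ℝ ℝ 1 ∘ₗ primal n m)
    (sandwich DX DY ∘ₗ primal n m - multMap n m ∘ₗ dual n m))

/-- The sign conditions, with the primal part vanishing on `I` and the sign multipliers off `I`. -/
def kktCone (I : Set (Fin n × Fin m)) : Set (KKTIdx n m → ℝ) :=
  {z | (∀ q, 0 ≤ z (.inl q) ∧ (q ∈ I → z (.inl q) = 0)) ∧ dual n m z ∈ multCone I}

theorem boxConnected_kktCone (I : Set (Fin n × Fin m)) : BoxConnected (kktCone I) :=
  fun _ hx _ hy _ hw => ⟨fun q => ⟨uIcc_nonneg (hx.1 q).1 (hy.1 q).1 (hw _),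
    fun h => uIcc_eq_zero ((hx.1 q).2 h) ((hy.1 q).2 h) (hw _)⟩,
    boxConnected_multCone I _ hx.2 _ hy.2 _ fun i => hw (.inr i)⟩

theorem isClosed_kktCone (I : Set (Fin n × Fin m)) : IsClosed (kktCone I) := by
  have : kktCone I = {z : KKTIdx n m → ℝ | ∀ q, 0 ≤ z (.inl q) ∧ (q ∈ I → z (.inl q) = 0)} ∩
      dual n m ⁻¹' multCone I := rfl
  rw [this]
  refine IsClosed.inter ?_
    ((isClosed_multCone I).preimage (dual n m).continuous_of_finiteDimensional)
  simp only [ofPred_forall, ofPred_and]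
  refine isClosed_iInter fun q => IsClosed.inter ?_ ?_
  · exact isClosed_le continuous_const (by fun_prop)
  · exact isClosed_iInter fun _ => isClosed_eq (by fun_prop) continuous_const

theorem zero_mem_kktCone (I : Set (Fin n × Fin m)) : 0 ∈ kktCone I :=
  ⟨fun _ => ⟨le_rfl, fun _ => rfl⟩, zero_mem_multCone I⟩

theorem kktMap_apply (DX : Matrix (Fin n) (Fin n) ℝ) (DY : Matrix (Fin m) (Fin m) ℝ)
    (z : KKTIdx n m → ℝ) : kktMap DX DY z = (primal n m z *ᵥ 1, 1 ᵥ* primal n m z,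
      sandwich DX DY (primal n m z) - multMap n m (dual n m z)) := rfl

/-- The primal part may vanish beyond `I`, but the multipliers supported in `I` remain complementary
to it. -/
theorem primal_mem_criticalSet {DX : Matrix (Fin n) (Fin n) ℝ} (hDX : DX.IsSymm)
    {DY : Matrix (Fin m) (Fin m) ℝ} (hDY : DY.IsSymm) {μ : Fin n → ℝ} {ν : Fin m → ℝ}
    {I : Set (Fin n × Fin m)} {z : KKTIdx n m → ℝ} (hz : z ∈ kktCone I)
    (h : kktMap DX DY z = (μ, ν, 0)) : primal n m z ∈ criticalSet DX DY μ ν := by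
  rw [kktMap_apply, Prod.mk.injEq, Prod.mk.injEq] at h
  obtain ⟨h1, h2, h3⟩ := h
  have h0 : ∀ i j, 0 ≤ primal n m z i j := fun i j => (hz.1 (i, j)).1
  refine mem_criticalSet hDX hDY ⟨⟨h0, h1⟩, ⟨h0, by rwa [Matrix.mulVec_transpose]⟩⟩
    (multCone_mono (fun q hq => (hz.1 q).2 hq) hz.2) (sub_eq_zero.1 h3).symm

/-- Local error bound for the generalized equation `D_X p D_Y + d ∈ N(p)` on the transport
polytope. -/
theorem exists_perturbation_bound {DX : Matrix (Fin n) (Fin n) ℝ} (hDX : DX.IsSymm)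
    {DY : Matrix (Fin m) (Fin m) ℝ} (hDY : DY.IsSymm) (μ : Fin n → ℝ) (ν : Fin m → ℝ) :
    ∃ ε : ℝ, 0 < ε ∧ ∃ τ : ℝ, 0 ≤ τ ∧ ∀ p d : Matrix (Fin n) (Fin m) ℝ,
      sandwich DX DY p + d ∈ normalCone (C₁ m μ ∩ C₂ n ν) p → ‖d‖ ≤ ε →
      ∃ y ∈ criticalSet DX DY μ ν, ‖p - y‖ ≤ τ * ‖d‖ := by
  choose ε hε τ hτ using fun I : Set (Fin n × Fin m) =>
    (boxConnected_kktCone I).exists_error_bound (isClosed_kktCone I) (zero_mem_kktCone I)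
      (kktMap DX DY) (μ, ν, 0)
  obtain ⟨M, hM⟩ := (Set.finite_range τ).bddAbove
  obtain ⟨I₀, hI₀⟩ := Finite.exists_min ε
  obtain ⟨K, hK, hP⟩ := exists_norm_le_mul_norm (primal n m)
  refine ⟨ε I₀, hε I₀, K * max M 0, by positivity, fun p d hd hle => ?_⟩
  obtain ⟨x, hx, hxd⟩ := exists_multipliers hd
  obtain ⟨hp, -⟩ := hd
  -- With the exact zero pattern of `p`, all sign and marginal conditions hold at `z`; the only
  -- defect is `-d` in the stationarity equation.
  set I : Set (Fin n × Fin m) := {q | p q.1 q.2 = 0}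
  set z : KKTIdx n m → ℝ := Sum.elim (fun q => p q.1 q.2) x
  have hz : z ∈ kktCone I := ⟨fun q => ⟨hp.1.1 q.1 q.2, fun hq => hq⟩, hx⟩
  have hpz : primal n m z = p := rfl
  have hxz : dual n m z = x := rfl
  have hres : kktMap DX DY z - (μ, ν, 0) = (0, 0, -d) := by
    rw [kktMap_apply, hpz, hxz, hxd, hp.1.2, ← Matrix.mulVec_transpose, hp.2.2]
    simp
  have hnorm : ‖kktMap DX DY z - (μ, ν, 0)‖ = ‖d‖ := by
    rw [hres]
    simp [Prod.norm_def]
  obtain ⟨y, hy, hyb, hyz⟩ := hτ I z hz (by rw [hnorm]; exact hle.trans (hI₀ I))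
  refine ⟨primal n m y, primal_mem_criticalSet hDX hDY hy hyb, ?_⟩
  rw [hnorm] at hyz
  calc ‖p - primal n m y‖ = ‖primal n m (z - y)‖ := by rw [map_sub, hpz]
    _ ≤ K * ‖z - y‖ := hP _
    _ ≤ K * (max M 0 * ‖d‖) := by
      gcongr
      exact hyz.trans (mul_le_mul_of_nonneg_right ((hM ⟨I, rfl⟩).trans (le_max_left _ _))
        (norm_nonneg _))
    _ = _ := by ring

end Critical

end GW

theorem mainTheorem1 {n m : ℕ}
    (DX : Matrix (Fin n) (Fin n) ℝ) (hDX : DX.IsSymm)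
    (DY : Matrix (Fin m) (Fin m) ℝ) (hDY : DY.IsSymm)
    (μ : Fin n → ℝ) (hμ : μ ∈ stdSimplex ℝ (Fin n))
    (ν : Fin m → ℝ) (hν : ν ∈ stdSimplex ℝ (Fin m)) :
    (GW.criticalSet DX DY μ ν).Nonempty ∧
    ∃ ε : ℝ, 0 < ε ∧ ∃ τ : ℝ, 0 < τ ∧
      ∀ π : Matrix (Fin n) (Fin m) ℝ, GW.residual DX DY μ ν π ≤ ε →
        Metric.infDist π (GW.criticalSet DX DY μ ν) ≤ τ * GW.residual DX DY μ ν π := by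
  refine ⟨GW.criticalSet_nonempty hDX hDY hμ hν, ?_⟩
  obtain ⟨ε, hε, τ, hτ, hbound⟩ := GW.exists_perturbation_bound hDX hDY μ ν
  set A := GW.sandwich DX DY with hA
  obtain ⟨K, hK0, hAK⟩ := GW.exists_norm_le_mul_norm A
  have hK : 0 < 1 + K := by positivity
  -- Since `‖d‖ ≤ (1 + K) ‖π - p‖`, this radius gives `‖d‖ ≤ ε`. The extra 1 in the second constant
  -- pays for the step from `π` to `p`.
  refine ⟨ε / (1 + K), by positivity, 1 + τ * (1 + K), by positivity, fun π hπ => ?_⟩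
  have hconv := GW.convex_couplings μ ν
  have hproj := GW.isProj_proj (GW.couplings_nonempty hμ hν)
    (GW.isClosed_couplings μ ν).isComplete hconv (π + DX * π * DY)
  unfold GW.residual at hπ ⊢
  set p := GW.proj (GW.C₁ m μ ∩ GW.C₂ n ν) (π + DX * π * DY)
  have hnormal : A p + (A (π - p) + (π - p)) ∈ GW.normalCone (GW.C₁ m μ ∩ GW.C₂ n ν) p := by
    have e : A p + (A (π - p) + (π - p)) = π + DX * π * DY - p := by
      rw [map_sub, ← GW.sandwich_apply, ← hA]
      abel
    rw [e]
    exact ⟨hproj.1, hproj.inner_le_zero hconv⟩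
  have hd : ‖A (π - p) + (π - p)‖ ≤ (1 + K) * ‖π - p‖ := by
    have := hAK (π - p)
    calc _ ≤ ‖A (π - p)‖ + ‖π - p‖ := norm_add_le _ _
      _ ≤ _ := by linarith
  obtain ⟨y, hy, hyp⟩ := hbound p _ hnormal (hd.trans (by
    rw [le_div_iff₀ hK] at hπ
    linarith))
  calc Metric.infDist π (GW.criticalSet DX DY μ ν) ≤ dist π y := Metric.infDist_le_dist_of_mem hy
    _ = ‖(π - p) + (p - y)‖ := by rw [dist_eq_norm, sub_add_sub_cancel]
    _ ≤ ‖π - p‖ + ‖p - y‖ := norm_add_le _ _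
    _ ≤ ‖π - p‖ + τ * ((1 + K) * ‖π - p‖) := by
      gcongr
      exact hyp.trans (mul_le_mul_of_nonneg_left hd hτ)
    _ = _ := by ring
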